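/- For a permutation $\sigma=\sigma_1\cdots\sigma_m\in\mathfrak S_m$ put $\sigma_0=\sigma_{m+1}=0$. Let - $V(\sigma)$ be the number of valleys: $1\le i\le m$ with $\sigma_{i-1}>\sigma_i<\sigma_{i+1}$; - $W(\sigma)$ be the number of exterior peaks: $1\le i\le m$ with $\sigma_{i-1}<\sigma_i>\sigma_{i+1}$; - $\mathrm{rdd}(\sigma)$ be the number of right double descents: $1<i\le m$ with $\sigma_{i-1}>\sigma_i>\sigma_{i+1}$; - $\mathrm{lda}(\sigma)$ be the number of left double ascents: $1\le i<m$ with $\sigma_{i-1}<\sigma_i<\sigma_{i+1}$; - $\mathrm{LRmax}(\sigma)$ (resp. $\mathrm{RLmax}(\sigma)$) be the number of $1\le i\le m$ with $\sigma_j<\sigma_i$ for all $1\le j<i$ (resp. for all $i<j\le m$). For $n\ge 0$ define $$P_n(u_1,u_2,u_3,u_4|\alpha,\beta)=\sum_{\sigma\in\mathfrak S_{n+1}}u_1^{V(\sigma)}u_2^{W(\sigma)-1}u_3^{\mathrm{rdd}(\sigma)}u_4^{\mathrm{lda}(\sigma)}\alpha^{\mathrm{LRmax}(\sigma)-1}\beta^{\mathrm{RLmax}(\sigma)-1}.$$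 **Theorem.** Let $R$ be a commutative $\mathbb Q$-algebra and let $u_1,u_2,u_3,u_4,\alpha,\beta,x,y\in R$ satisfy $x+y=u_3+u_4$ and $xy=u_1u_2$. Then, as formal power series in $t$ over $R$, $$\sum_{n\ge 0}P_n(u_1,u_2,u_3,u_4|\alpha,\beta)\frac{t^n}{n!}=\bigl(1+yF(x,y;t)\bigr)^{\frac{\alpha+\beta}{2}}\bigl(1+xF(x,y;t)\bigr)^{\frac{\alpha+\beta}{2}}e^{\frac12(\beta-\alpha)(u_3-u_4)t}.$$ Here $$F(x,y;t)=\frac{e^{xt}-e^{yt}}{xe^{yt}-ye^{xt}},$$ where the common factor $x-y$ of numerator and denominator is cancelled before evaluating at $x,y\in R$ (so $F$ is a power series in $t$ whose coefficients are polynomials in $x,y$ over $\mathbb Q$; for instance $F(x,x;t)=t/(1-xt)$), and for a power series $g$ without constant term and $c\in R$, $(1+g)^c=\sum_{k\ge0}\frac{c(c-1)\cdots(c-k+1)}{k!}\,g^k$. -/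

import Mathlib

namespace DescentStirling

/-! ### Permutations as words and their statistics

A permutation `σ` of `[m]` is an element of `Equiv.Perm (Fin m)`; it is read as the word
`σ_1 σ_2 ⋯ σ_m` in the letters `1, …, m`, with the convention `σ_0 = σ_{m+1} = 0`. -/

/-- The letter `σ_i ∈ {1, …, m}` for `1 ≤ i ≤ m`; it is `0` for `i = 0` and for `i > m`. -/
def letter {m : ℕ} (σ : Equiv.Perm (Fin m)) (i : ℕ) : ℕ :=
  if h : 1 ≤ i ∧ i ≤ m then (σ ⟨i - 1, by omega⟩ : ℕ) + 1 else 0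

/-- `V(σ)`: the number of valleys, `1 ≤ i ≤ m` with `σ_{i-1} > σ_i < σ_{i+1}`. -/
def valleys {m : ℕ} (σ : Equiv.Perm (Fin m)) : ℕ :=
  ((Finset.Icc 1 m).filter fun i =>
    letter σ (i - 1) > letter σ i ∧ letter σ i < letter σ (i + 1)).card

/-- `W(σ)`: the number of exterior peaks, `1 ≤ i ≤ m` with `σ_{i-1} < σ_i > σ_{i+1}`. -/
def exteriorPeaks {m : ℕ} (σ : Equiv.Perm (Fin m)) : ℕ :=
  ((Finset.Icc 1 m).filter fun i =>
    letter σ (i - 1) < letter σ i ∧ letter σ i > letter σ (i + 1)).card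

/-- `rdd(σ)`: the number of right double descents, `1 < i ≤ m` with
`σ_{i-1} > σ_i > σ_{i+1}`. -/
def rightDoubleDescents {m : ℕ} (σ : Equiv.Perm (Fin m)) : ℕ :=
  ((Finset.Ioc 1 m).filter fun i =>
    letter σ (i - 1) > letter σ i ∧ letter σ i > letter σ (i + 1)).card

/-- `lda(σ)`: the number of left double ascents, `1 ≤ i < m` with
`σ_{i-1} < σ_i < σ_{i+1}`. -/
def leftDoubleAscents {m : ℕ} (σ : Equiv.Perm (Fin m)) : ℕ :=
  ((Finset.Ico 1 m).filter fun i =>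
    letter σ (i - 1) < letter σ i ∧ letter σ i < letter σ (i + 1)).card

/-- `LRmax(σ)`: the number of left-to-right maxima, `1 ≤ i ≤ m` with `σ_j < σ_i` for all
`1 ≤ j < i`. -/
def lrMax {m : ℕ} (σ : Equiv.Perm (Fin m)) : ℕ :=
  ((Finset.Icc 1 m).filter fun i : ℕ => ∀ j ∈ Finset.Icc (1 : ℕ) m, j < i → letter σ j < letter σ i).card

/-- `RLmax(σ)`: the number of right-to-left maxima, `1 ≤ i ≤ m` with `σ_j < σ_i` for all
`i < j ≤ m`. -/
def rlMax {m : ℕ} (σ : Equiv.Perm (Fin m)) : ℕ :=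
  ((Finset.Icc 1 m).filter fun i : ℕ => ∀ j ∈ Finset.Icc (1 : ℕ) m, i < j → letter σ j < letter σ i).card

/-! The three exponents `W(σ) - 1`, `LRmax(σ) - 1`, `RLmax(σ) - 1` below are genuine (not
truncated) differences, since these statistics are positive on a nonempty word. -/

theorem one_le_lrMax {n : ℕ} (σ : Equiv.Perm (Fin (n + 1))) : 1 ≤ lrMax σ := by
  refine Finset.card_pos.mpr ⟨1, ?_⟩
  simp only [Finset.mem_filter, Finset.mem_Icc]
  exact ⟨by omega, fun j hj hj1 => by omega⟩

theorem one_le_rlMax {n : ℕ} (σ : Equiv.Perm (Fin (n + 1))) : 1 ≤ rlMax σ := by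
  refine Finset.card_pos.mpr ⟨n + 1, ?_⟩
  simp only [Finset.mem_filter, Finset.mem_Icc]
  exact ⟨by omega, fun j hj hj1 => by omega⟩

theorem one_le_exteriorPeaks {n : ℕ} (σ : Equiv.Perm (Fin (n + 1))) :
    1 ≤ exteriorPeaks σ := by
  obtain ⟨k, hk⟩ := σ.surjective (Fin.last n)
  have hmax : ∀ i, i ≠ (k : ℕ) + 1 → letter σ i < letter σ ((k : ℕ) + 1) := by
    intro i hi
    have h1 : letter σ ((k : ℕ) + 1) = n + 1 := by
      have h0 : 1 ≤ (k : ℕ) + 1 ∧ (k : ℕ) + 1 ≤ n + 1 := by omega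
      rw [letter, dif_pos h0]
      simp [hk]
    rw [h1, letter]
    split_ifs with h
    · have hne : σ ⟨i - 1, by omega⟩ ≠ Fin.last n := by
        intro h2
        have h3 := congrArg Fin.val (σ.injective (h2.trans hk.symm))
        simp only at h3
        omega
      have := Fin.val_lt_last hne
      omega
    · omega
  refine Finset.card_pos.mpr ⟨(k : ℕ) + 1, ?_⟩
  simp only [Finset.mem_filter, Finset.mem_Icc]
  exact ⟨by omega, hmax _ (by omega), hmax _ (by omega)⟩

/-- `P_n(u₁,u₂,u₃,u₄|α,β)`: the sum over all permutations of `[n+1]` of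
`u₁^V u₂^(W-1) u₃^rdd u₄^lda α^(LRmax-1) β^(RLmax-1)`. -/
def P {R : Type*} [CommRing R] (n : ℕ) (u₁ u₂ u₃ u₄ α β : R) : R :=
  ∑ σ : Equiv.Perm (Fin (n + 1)),
    u₁ ^ valleys σ * u₂ ^ (exteriorPeaks σ - 1) * u₃ ^ rightDoubleDescents σ *
      u₄ ^ leftDoubleAscents σ * α ^ (lrMax σ - 1) * β ^ (rlMax σ - 1)

/-! ### Formal power series in `t` over a commutative `ℚ`-algebra -/

open PowerSeries

section Series

variable {R : Type*} [CommRing R] [Algebra ℚ R]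

/-- The exponential generating function `∑ aₙ tⁿ / n!`. -/
noncomputable def egf (a : ℕ → R) : PowerSeries R :=
  PowerSeries.mk fun n => (1 / (n.factorial : ℚ)) • a n

/-- The series `e^{ct}`. -/
noncomputable def expSeries (c : R) : PowerSeries R :=
  PowerSeries.rescale c (PowerSeries.exp R)

/-- The binomial series `(1 + X)^c = ∑ₖ c (c-1) ⋯ (c-k+1) Xᵏ / k!` with exponent `c ∈ R`. -/
noncomputable def binomSeries (c : R) : PowerSeries R :=
  egf fun k => ∏ i ∈ Finset.range k, (c - (i : R))

/-- The power `(1 + g)^c` with exponent `c ∈ R`, for a series `g` without constant term: the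
series `g` substituted into the binomial series. -/
noncomputable def onePlusPow (g : PowerSeries R) (c : R) : PowerSeries R :=
  (binomSeries c).subst g

theorem constantCoeff_expSeries (c : R) : constantCoeff (expSeries c) = 1 := by
  rw [← coeff_zero_eq_constantCoeff_apply, expSeries, coeff_rescale]
  simp

/-- The divided difference `(e^{xt} - e^{yt}) / (x - y)`, that is
`∑ₙ (∑_{i+j=n-1} xⁱ yʲ) tⁿ / n!`. -/
noncomputable def expDivDiff (x y : R) : PowerSeries R :=
  egf fun n => ∑ i ∈ Finset.range n, x ^ i * y ^ (n - 1 - i)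

/-- The series `F(x,y;t) = (e^{xt} - e^{yt}) / (x e^{yt} - y e^{xt})`. Numerator and denominator
are both divisible by `x - y`; after cancelling this factor the numerator is `expDivDiff x y`
and the denominator is `e^{yt} - y * expDivDiff x y`, which has constant term `1` and so is
invertible. See `F_mul`, `eq_F_of_mul_eq` and `F_eq_mul_inv` for the relation with the quotient. -/
noncomputable def F (x y : R) : PowerSeries R :=
  expDivDiff x y * PowerSeries.invOfUnit (expSeries y - PowerSeries.C y * expDivDiff x y) 1

theorem sub_mul_expDivDiff (x y : R) :
    C (x - y) * expDivDiff x y = expSeries x - expSeries y := by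
  ext n
  have h : (x - y) * ∑ i ∈ Finset.range n, x ^ i * y ^ (n - 1 - i) = x ^ n - y ^ n := by
    rw [mul_comm]; exact (Commute.all x y).geom_sum₂_mul n
  rw [coeff_C_mul, map_sub]
  simp only [expDivDiff, egf, expSeries, coeff_mk, coeff_rescale, coeff_exp]
  rw [mul_smul_comm, h, Algebra.smul_def]
  ring

theorem constantCoeff_expDivDiff (x y : R) : constantCoeff (expDivDiff x y) = 0 := by
  rw [← coeff_zero_eq_constantCoeff_apply]
  simp [expDivDiff, egf]

theorem F_mul_reduced (x y : R) :
    F x y * (expSeries y - C y * expDivDiff x y) = expDivDiff x y := by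
  have h : constantCoeff (expSeries y - C y * expDivDiff x y) = ((1 : Rˣ) : R) := by
    rw [map_sub, map_mul, constantCoeff_expDivDiff, constantCoeff_expSeries]
    simp
  rw [F, mul_assoc, mul_comm (invOfUnit _ _), mul_invOfUnit _ _ h, mul_one]

theorem constantCoeff_F (x y : R) : constantCoeff (F x y) = 0 := by
  rw [F, map_mul, constantCoeff_expDivDiff, zero_mul]

theorem denom_eq (x y : R) :
    C x * expSeries y - C y * expSeries x =
      C (x - y) * (expSeries y - C y * expDivDiff x y) := by
  have h := sub_mul_expDivDiff x y
  simp only [map_sub] at h ⊢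
  linear_combination C y * h

/-- `F(x,y;t) (x e^{yt} - y e^{xt}) = e^{xt} - e^{yt}`. -/
theorem F_mul (x y : R) :
    F x y * (C x * expSeries y - C y * expSeries x) = expSeries x - expSeries y := by
  rw [denom_eq, ← sub_mul_expDivDiff, mul_left_comm, F_mul_reduced]

/-- If `x - y` is not a zero divisor, `F(x,y;t)` is the only solution of
`G (x e^{yt} - y e^{xt}) = e^{xt} - e^{yt}`. -/
theorem eq_F_of_mul_eq (x y : R) (hxy : x - y ∈ nonZeroDivisors R) (G : PowerSeries R)
    (hG : G * (C x * expSeries y - C y * expSeries x) = expSeries x - expSeries y) :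
    G = F x y := by
  have h1 : C (x - y) * ((G - F x y) * (expSeries y - C y * expDivDiff x y)) = 0 := by
    have h2 := F_mul x y
    rw [denom_eq] at hG h2
    linear_combination hG - h2
  have h3 : (G - F x y) * (expSeries y - C y * expDivDiff x y) = 0 := by
    ext n
    have h4 := congrArg (coeff n) h1
    rw [coeff_C_mul, map_zero, mul_comm] at h4
    rw [map_zero]
    exact (mem_nonZeroDivisors_iff_right.mp hxy) _ h4
  have hu : IsUnit (expSeries y - C y * expDivDiff x y) := by
    rw [isUnit_iff_constantCoeff, map_sub, map_mul, constantCoeff_expDivDiff, constantCoeff_expSeries]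
    simp
  exact sub_eq_zero.mp (hu.mul_left_eq_zero.mp h3)

end Series

/-- Over a field, for `x ≠ y`, `F(x,y;t)` is literally the quotient
`(e^{xt} - e^{yt}) / (x e^{yt} - y e^{xt})` of formal power series. -/
theorem F_eq_mul_inv {K : Type*} [Field K] [Algebra ℚ K] (x y : K) (hxy : x ≠ y) :
    F x y = (expSeries x - expSeries y) * (C x * expSeries y - C y * expSeries x)⁻¹ := by
  rw [PowerSeries.eq_mul_inv_iff_mul_eq, F_mul]
  rw [map_sub, map_mul, map_mul, constantCoeff_expSeries, constantCoeff_expSeries]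
  simpa using sub_ne_zero.mpr hxy

end DescentStirling

/-!
The proof cuts a permutation at its largest letter `M = n + 1`, written as `σ = L M R`. Left-to-right
maxima other than `M` lie in `L`, right-to-left maxima other than `M` lie in `R`, and valleys,
peaks and double ascents or descents are counted separately in `L` (between the letters `0` and
`M`) and in `R` (between `M` and `0`). Hence the generating function is a product `A B`, where `A`
counts words between a small and a large letter with `α` marking left-to-right maxima, and `B`
counts words between a large and a small letter with `β` marking right-to-left maxima
(`sum_word_statistics`).

Cutting again at the largest letter gives differential equations. Let `S` be the generating function
of nonempty words between two large letters. The largest letter of such a word is a valley, a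
double descent, a double ascent or a peak according to which of the two parts around it are empty,
so `S' = u₁ + (u₃ + u₄) S + u₂ S²`. In the same way `A' = α (u₄ + u₂ S) A` and
`B' = β (u₃ + u₂ S) B`. Since `F' = (1 + x F) (1 + y F)` (`derivative_F`), the hypotheses on `x` and
`y` say that `u₁ F` solves the equation of `S`, so `S = u₁ F` (`sum_wordWeight`). The closed form
`E(α, β)` on the right-hand side satisfies
`E(α, β)' = (α u₄ + β u₃ + (α + β) u₁ u₂ F) E(α, β)` (`derivative_closedForm`); this identifies `A`
with `E(α, 0)` (`sum_wordWeight_mul_pow_lrMaxCount`), `B` with `E(0, β)`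
(`sum_wordWeight_mul_pow_rlMaxCount`) and `A B` with `E(α, β)` (`closedForm_mul`).

Words are lists of natural numbers on an arbitrary finite set of letters. The sum over all words on
such a set only depends on the number of letters, which is proved by induction together with
the identification of the sum as a coefficient of the series, so no relabelling of letters is needed.
-/

namespace DescentStirling

open PowerSeries

/-! ### Exponential coefficients and linear differential equations -/

section Series

variable {R : Type*} [CommRing R]

/-- The coefficients of a series with respect to the monomials `t ^ n / n!`. -/
noncomputable def egfCoeff (n : ℕ) (S : PowerSeries R) : R :=
  (n.factorial : R) * coeff n S

@[simp] theorem egfCoeff_zero (S : PowerSeries R) : egfCoeff 0 S = constantCoeff S := by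
  simp [egfCoeff]

theorem egfCoeff_succ (n : ℕ) (S : PowerSeries R) :
    egfCoeff (n + 1) S = egfCoeff n (d⁄dX R S) := by
  rw [egfCoeff, egfCoeff, coeff_derivative, Nat.factorial_succ]
  push_cast
  ring

theorem egfCoeff_add (n : ℕ) (S T : PowerSeries R) :
    egfCoeff n (S + T) = egfCoeff n S + egfCoeff n T := by
  simp [egfCoeff, mul_add]

theorem egfCoeff_C_mul (n : ℕ) (r : R) (S : PowerSeries R) :
    egfCoeff n (C r * S) = r * egfCoeff n S := by
  rw [egfCoeff, egfCoeff, coeff_C_mul]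
  ring

theorem egfCoeff_C (n : ℕ) (r : R) : egfCoeff n (C r) = if n = 0 then r else 0 := by
  rw [egfCoeff, coeff_C]
  split_ifs with h <;> simp [h]

theorem egfCoeff_one (n : ℕ) : egfCoeff n (1 : PowerSeries R) = if n = 0 then 1 else 0 := by
  rw [← map_one C, egfCoeff_C]

/-- Products of exponential generating functions are binomial convolutions. -/
theorem egfCoeff_mul (n : ℕ) (S T : PowerSeries R) :
    egfCoeff n (S * T) = ∑ k ∈ Finset.range (n + 1),
      n.choose k • (egfCoeff k S * egfCoeff (n - k) T) := by
  rw [egfCoeff, coeff_mul, Finset.Nat.sum_antidiagonal_eq_sum_range_succ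
    (fun i j => coeff i S * coeff j T), Finset.mul_sum]
  refine Finset.sum_congr rfl fun k hk => ?_
  rw [← Nat.choose_mul_factorial_mul_factorial (Finset.mem_range_succ_iff.mp hk), egfCoeff,
    egfCoeff, nsmul_eq_mul]
  push_cast
  ring

variable [Algebra ℚ R]

/-- Two power series over a `ℚ`-algebra that solve the same linear equation `S' = H S` and have
the same constant term are equal. -/
theorem eq_of_derivative_eq_mul {H S T : PowerSeries R} (hS : d⁄dX R S = H * S)
    (hT : d⁄dX R T = H * T) (h0 : constantCoeff S = constantCoeff T) : S = T := by
  ext n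
  induction n using Nat.strong_induction_on with
  | _ n ih =>
    cases n with
    | zero => simpa using h0
    | succ n =>
      have h1 : coeff n (d⁄dX R S) = coeff n (d⁄dX R T) := by
        rw [hS, hT, coeff_mul, coeff_mul]
        refine Finset.sum_congr rfl fun p hp => ?_
        rw [ih p.2 (by have := Finset.HasAntidiagonal.mem_antidiagonal.mp hp; omega)]
      rw [coeff_derivative, coeff_derivative] at h1
      have hu : IsUnit ((n : R) + 1) := by
        have := (IsUnit.mk0 ((n : ℚ) + 1) (by positivity)).map (algebraMap ℚ R)
        simpa using this
      exact hu.mul_right_cancel h1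

theorem factorial_inv_smul_factorial_mul (n : ℕ) (r : R) :
    (1 / (n.factorial : ℚ)) • ((n.factorial : R) * r) = r := by
  have h : (n.factorial : ℚ) ≠ 0 := by positivity
  rw [← nsmul_eq_mul, ← Nat.cast_smul_eq_nsmul ℚ, smul_smul, one_div_mul_cancel h, one_smul]

theorem egf_egfCoeff (S : PowerSeries R) : egf (fun n => egfCoeff n S) = S := by
  ext n
  rw [egf, coeff_mk, egfCoeff, factorial_inv_smul_factorial_mul]

theorem derivative_egf (a : ℕ → R) : d⁄dX R (egf a) = egf fun n => a (n + 1) := by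
  ext n
  rw [coeff_derivative, egf, egf, coeff_mk, coeff_mk, Nat.factorial_succ]
  have h1 : (n : R) + 1 = algebraMap ℚ R ((n : ℚ) + 1) := by simp
  rw [h1, mul_comm, ← Algebra.smul_def, smul_smul]
  congr 1
  have : (n.factorial : ℚ) ≠ 0 := by positivity
  push_cast
  field_simp

/-! ### Differential equations for the series in the closed form -/

theorem expSeries_eq_egf (c : R) : expSeries c = egf fun n => c ^ n := by
  ext n
  rw [expSeries, egf, coeff_rescale, coeff_exp, coeff_mk, Algebra.smul_def, mul_comm]

theorem C_mul_egf (c : R) (a : ℕ → R) : C c * egf a = egf fun n => c * a n := by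
  ext n
  simp [egf, coeff_C_mul]

theorem egf_add (a b : ℕ → R) : egf a + egf b = egf fun n => a n + b n := by
  ext n
  simp [egf]

theorem derivative_expSeries (c : R) : d⁄dX R (expSeries c) = C c * expSeries c := by
  rw [expSeries_eq_egf, derivative_egf, C_mul_egf]
  simp only [pow_succ']

/-- The complete homogeneous sums `hₙ = ∑_{i+j=n-1} xⁱ yʲ` satisfy `hₙ₊₁ = xⁿ + y hₙ`. -/
theorem derivative_expDivDiff (x y : R) :
    d⁄dX R (expDivDiff x y) = expSeries x + C y * expDivDiff x y := by
  rw [expDivDiff, derivative_egf, expSeries_eq_egf, C_mul_egf, egf_add]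
  congr 1
  funext n
  exact (Commute.all x y).geom_sum₂_succ_eq

/-- The Riccati equation satisfied by `F`. -/
theorem derivative_F (x y : R) :
    d⁄dX R (F x y) = (1 + C x * F x y) * (1 + C y * F x y) := by
  have hu : IsUnit (expSeries y - C y * expDivDiff x y) := by
    rw [isUnit_iff_constantCoeff, map_sub, map_mul, constantCoeff_expDivDiff,
      constantCoeff_expSeries]
    simp
  have h1 := F_mul_reduced x y
  have h2 := congrArg (d⁄dX R) h1
  have h3 := sub_mul_expDivDiff x y
  simp only [Derivation.leibniz, map_sub, derivative_expSeries, derivative_expDivDiff,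
    derivative_C, smul_eq_mul] at h2 h3
  -- With `E = expDivDiff x y` and `D = e^{yt} - y E`, the claim follows from `F D = E` and its
  -- derivative, since `E' = e^{xt} + y E` and `(x - y) E = e^{xt} - e^{yt}`.
  refine hu.mul_right_cancel ?_
  linear_combination h2 - C y * F x y * h3 - h3 -
    (C x + C y + C x * C y * F x y) * h1

/-- `(1 + t) B' = c B` for the binomial series `B = (1 + t) ^ c`. -/
theorem derivative_binomSeries (c : R) :
    (1 + X) * d⁄dX R (binomSeries c) = C c * binomSeries c := by
  have h : X * d⁄dX R (binomSeries c) =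
      egf fun n => (n : R) * ∏ i ∈ Finset.range n, (c - (i : R)) := by
    ext n
    cases n with
    | zero => simp [egf]
    | succ n =>
      rw [coeff_succ_X_mul, coeff_derivative, binomSeries, egf, egf, coeff_mk, coeff_mk,
        mul_comm, mul_smul_comm]
      push_cast
      rfl
  rw [add_mul, one_mul, h, binomSeries, C_mul_egf, derivative_egf, egf_add]
  congr 1
  funext n
  rw [Finset.prod_range_succ]
  ring

theorem constantCoeff_binomSeries (c : R) : constantCoeff (binomSeries c) = 1 := by
  rw [← coeff_zero_eq_constantCoeff_apply]
  simp [binomSeries, egf]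

/-- The power rule for `(1 + g) ^ c`, with the factor `1 + g` cleared. -/
theorem derivative_onePlusPow {g : PowerSeries R} (hg : constantCoeff g = 0) (c : R) :
    (1 + g) * d⁄dX R (onePlusPow g c) = C c * d⁄dX R g * onePlusPow g c := by
  have hs := HasSubst.of_constantCoeff_zero' hg
  have h1 := congrArg (fun S : PowerSeries R => S.subst g) (derivative_binomSeries c)
  simp only [subst_mul hs, subst_add hs, subst_X hs] at h1
  have h2 : (1 : PowerSeries R).subst g = (1 : PowerSeries R) := by
    rw [← coe_substAlgHom hs, map_one]
  have h3 : (C c : PowerSeries R).subst g = (C c : PowerSeries R) := subst_C c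
  rw [h2, h3] at h1
  rw [onePlusPow, derivative_subst hs]
  linear_combination d⁄dX R g * h1

theorem constantCoeff_onePlusPow {g : PowerSeries R} (hg : constantCoeff g = 0) (c : R) :
    constantCoeff (onePlusPow g c) = 1 := by
  have hs := HasSubst.of_constantCoeff_zero' hg
  have h : binomSeries c = C 1 + (binomSeries c - C 1) := by ring
  have h1 : constantCoeff ((binomSeries c - C 1).subst g : PowerSeries R) = 0 :=
    constantCoeff_subst_eq_zero hg _ (by simp [constantCoeff_binomSeries])
  rw [onePlusPow, h, subst_add hs, map_add, h1]
  have h3 : (C 1 : PowerSeries R).subst g = (C 1 : PowerSeries R) := subst_C 1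
  rw [h3]
  simp

/-- The series `(1 + y F)^((α+β)/2) (1 + x F)^((α+β)/2) e^{(β-α)dt/2}`; the parameter `d` stands for
`u₃ - u₄`. -/
noncomputable def closedForm (x y d α β : R) : PowerSeries R :=
  onePlusPow (C y * F x y) ((1 / 2 : ℚ) • (α + β)) *
    onePlusPow (C x * F x y) ((1 / 2 : ℚ) • (α + β)) *
    expSeries ((1 / 2 : ℚ) • ((β - α) * d))

theorem constantCoeff_closedForm (x y d α β : R) :
    constantCoeff (closedForm x y d α β) = 1 := by
  rw [closedForm, map_mul, map_mul, constantCoeff_onePlusPow, constantCoeff_onePlusPow,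
    constantCoeff_expSeries] <;> simp [constantCoeff_F]

theorem derivative_onePlusPow_F (x y c : R) :
    d⁄dX R (onePlusPow (C y * F x y) c) =
      C c * C y * (1 + C x * F x y) * onePlusPow (C y * F x y) c := by
  have h0 : constantCoeff (C y * F x y) = 0 := by simp [constantCoeff_F]
  have hu : IsUnit (1 + C y * F x y) := by
    rw [isUnit_iff_constantCoeff, map_add, h0]
    simp
  have h := derivative_onePlusPow h0 c
  simp only [Derivation.leibniz, derivative_C, derivative_F, smul_eq_mul] at h
  refine hu.mul_left_cancel ?_
  linear_combination h

theorem F_comm (x y : R) : F x y = F y x := by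
  have h := sub_mul_expDivDiff x y
  have h1 : expDivDiff x y = expDivDiff y x := by
    unfold expDivDiff
    congr 1
    funext n
    exact (Commute.all x y).geom_sum₂_comm n
  rw [F, F, ← h1]
  congr 2
  simp only [map_sub] at h
  linear_combination h

/-- The logarithmic derivative of the closed form. The binomial factors contribute
`(α + β) / 2 * (y * (1 + x F) + x * (1 + y F)) = (α + β) / 2 * (u₃ + u₄) + (α + β) * u₁ u₂ F`,
and the exponential factor turns the constant term into `α u₄ + β u₃`. -/
theorem derivative_closedForm {u₁ u₂ u₃ u₄ x y : R} (hadd : x + y = u₃ + u₄)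
    (hmul : x * y = u₁ * u₂) (α β : R) :
    d⁄dX R (closedForm x y (u₃ - u₄) α β) =
      (C (α * u₄ + β * u₃) + C ((α + β) * u₂) * (C u₁ * F x y)) *
        closedForm x y (u₃ - u₄) α β := by
  have h := derivative_onePlusPow_F y x ((1 / 2 : ℚ) • (α + β))
  rw [F_comm y x] at h
  simp only [closedForm, Derivation.leibniz, smul_eq_mul, h, derivative_onePlusPow_F,
    derivative_expSeries]
  -- Every element of `R` is the sum of its two halves.
  have h2 (r : R) : C r = C ((1 / 2 : ℚ) • r) + C ((1 / 2 : ℚ) • r) := by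
    rw [← map_add, ← add_smul]
    norm_num
  have e1 : C (α * u₄ + β * u₃) = C ((1 / 2 : ℚ) • (α + β)) * (C x + C y) +
      C ((1 / 2 : ℚ) • ((β - α) * (u₃ - u₄))) := by
    rw [← map_add, hadd, ← map_mul, ← map_add]
    congr 1
    rw [smul_mul_assoc, ← smul_add]
    have : (α + β) * (u₃ + u₄) + (β - α) * (u₃ - u₄) = (2 : ℚ) • (α * u₄ + β * u₃) := by
      rw [ofNat_smul_eq_nsmul ℚ 2, nsmul_eq_mul]
      push_cast
      ring
    rw [this, smul_smul]
    norm_num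
  have e2 : C ((α + β) * u₂) * (C u₁ * F x y) =
      (C ((1 / 2 : ℚ) • (α + β)) + C ((1 / 2 : ℚ) • (α + β))) * (C x * C y) * F x y := by
    rw [← h2, ← map_mul C x y, hmul]
    simp only [map_mul]
    ring
  rw [e1, e2]
  ring

/-- The closed form factors into a part that only involves `α` and one that only involves `β`. -/
theorem closedForm_mul {u₁ u₂ u₃ u₄ x y : R} (hadd : x + y = u₃ + u₄)
    (hmul : x * y = u₁ * u₂) (α β : R) :
    closedForm x y (u₃ - u₄) α 0 * closedForm x y (u₃ - u₄) 0 β =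
      closedForm x y (u₃ - u₄) α β := by
  refine eq_of_derivative_eq_mul ?_ (derivative_closedForm hadd hmul α β) ?_
  · rw [Derivation.leibniz, derivative_closedForm hadd hmul, derivative_closedForm hadd hmul]
    simp only [smul_eq_mul, map_add, map_mul, map_zero]
    ring
  · simp [constantCoeff_closedForm]

theorem constantCoeff_C_mul_F (u x y : R) : constantCoeff (C u * F x y) = 0 := by
  simp [constantCoeff_F]

/-- The Riccati equation `S' = u₁ + (u₃ + u₄) S + u₂ S²` for `S = u₁ F`. -/
theorem derivative_C_mul_F {u₁ u₂ u₃ u₄ x y : R} (hadd : x + y = u₃ + u₄)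
    (hmul : x * y = u₁ * u₂) :
    d⁄dX R (C u₁ * F x y) = C u₁ + C (u₃ + u₄) * (C u₁ * F x y) +
      C u₂ * ((C u₁ * F x y) * (C u₁ * F x y)) := by
  have h1 : C x * C y = C u₁ * C u₂ := by rw [← map_mul, hmul, map_mul]
  simp only [Derivation.leibniz, derivative_C, derivative_F, smul_eq_mul]
  rw [← hadd, map_add]
  linear_combination C u₁ * F x y * F x y * h1

end Series

/-! ### Words on a finite set of letters -/

/-- The words that use every letter of `s` exactly once. -/
def words (s : Finset ℕ) : Finset (List ℕ) := s.val.lists.toFinset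

theorem mem_words {s : Finset ℕ} {l : List ℕ} : l ∈ words s ↔ l.Nodup ∧ l.toFinset = s := by
  rw [words, Multiset.mem_toFinset, Multiset.mem_lists_iff]
  constructor
  · intro h
    have hn : l.Nodup := by
      have := s.nodup
      rw [h] at this
      exact this
    refine ⟨hn, Finset.val_injective ?_⟩
    rw [h, List.toFinset_val, hn.dedup]
    rfl
  · rintro ⟨hn, rfl⟩
    rw [List.toFinset_val, hn.dedup]
    rfl

theorem mem_of_mem_words {s : Finset ℕ} {l : List ℕ} (h : l ∈ words s) {x : ℕ} :
    x ∈ l ↔ x ∈ s := by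
  rw [← (mem_words.mp h).2, List.mem_toFinset]

theorem length_of_mem_words {s : Finset ℕ} {l : List ℕ} (h : l ∈ words s) :
    l.length = s.card := by
  obtain ⟨hn, rfl⟩ := mem_words.mp h
  exact (List.toFinset_card_of_nodup hn).symm

theorem words_empty : words ∅ = {[]} := by
  ext l
  rw [mem_words, Finset.mem_singleton, List.toFinset_eq_empty_iff]
  exact ⟨fun h => h.2, fun h => ⟨h ▸ List.nodup_nil, h⟩⟩

/-- Cutting a word at the letter `M` gives a subset `A` of the other letters, a word on `A` and a
word on the complement of `A`. -/
theorem sum_words_insert {R : Type*} [AddCommMonoid R] {s : Finset ℕ} {M : ℕ} (hM : M ∉ s)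
    (g : List ℕ → R) :
    ∑ l ∈ words (insert M s), g l = ∑ A ∈ s.powerset, ∑ l₁ ∈ words A, ∑ l₂ ∈ words (s \ A),
      g (l₁ ++ M :: l₂) := by
  simp only [← Finset.sum_product']
  rw [Finset.sum_sigma']
  symm
  refine Finset.sum_bij (fun p _ => p.2.1 ++ M :: p.2.2) ?_ ?_ ?_ (fun _ _ => rfl)
  · rintro ⟨A, l₁, l₂⟩ h
    simp only [Finset.mem_sigma, Finset.mem_powerset, Finset.mem_product] at h
    obtain ⟨hA, h₁, h₂⟩ := h
    have m₁ := @mem_of_mem_words _ _ h₁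
    have m₂ := @mem_of_mem_words _ _ h₂
    rw [mem_words]
    refine ⟨?_, ?_⟩
    · rw [List.nodup_append, List.nodup_cons]
      refine ⟨(mem_words.mp h₁).1, ⟨?_, (mem_words.mp h₂).1⟩, ?_⟩
      · rw [m₂]
        exact fun h => hM (Finset.mem_sdiff.mp h).1
      · intro a ha b hb
        rw [m₁] at ha
        rcases List.mem_cons.mp hb with rfl | hb
        · rintro rfl
          exact hM (hA ha)
        · rw [m₂, Finset.mem_sdiff] at hb
          rintro rfl
          exact hb.2 ha
    · ext x
      simp only [List.mem_toFinset, List.mem_append, List.mem_cons, m₁, m₂, Finset.mem_insert,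
        Finset.mem_sdiff]
      have := @hA x
      tauto
  · rintro ⟨A, l₁, l₂⟩ h ⟨A', l₁', l₂'⟩ h' heq
    simp only [Finset.mem_sigma, Finset.mem_powerset, Finset.mem_product] at h h' heq
    have n₁ : M ∉ l₁ := fun hm => hM (h.1 ((mem_of_mem_words h.2.1).mp hm))
    have n₂ : M ∉ l₂ := fun hm =>
      hM (Finset.mem_sdiff.mp ((mem_of_mem_words h.2.2).mp hm)).1
    obtain ⟨rfl, -, rfl⟩ := (List.append_cons_inj_of_notMem n₁ n₂).mp heq
    have : A = A' := (mem_words.mp h.2.1).2.symm.trans (mem_words.mp h'.2.1).2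
    subst this
    rfl
  · intro l hl
    obtain ⟨l₁, l₂, rfl⟩ := List.append_of_mem
      ((mem_of_mem_words hl).mpr (Finset.mem_insert_self M s))
    obtain ⟨hn, hs⟩ := mem_words.mp hl
    rw [List.nodup_append, List.nodup_cons] at hn
    obtain ⟨hn₁, ⟨hM₂, hn₂⟩, hd⟩ := hn
    have hM₁ : M ∉ l₁ := fun h => hd M h M (by simp) rfl
    have hx (x : ℕ) : x ∈ s ↔ x ∈ l₁ ∨ x ∈ l₂ := by
      have h1 := Finset.ext_iff.mp hs x
      simp only [List.mem_toFinset, List.mem_append, List.mem_cons, Finset.mem_insert] at h1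
      by_cases hxM : x = M
      · subst hxM
        simp [hM, hM₁, hM₂]
      · simp only [hxM, false_or] at h1
        exact h1.symm
    refine ⟨⟨l₁.toFinset, l₁, l₂⟩, ?_, rfl⟩
    simp only [Finset.mem_sigma, Finset.mem_powerset, Finset.mem_product, mem_words]
    refine ⟨fun x h => (hx x).mpr (Or.inl (List.mem_toFinset.mp h)), ⟨hn₁, trivial⟩, hn₂, ?_⟩
    ext x
    simp only [Finset.mem_sdiff, List.mem_toFinset, hx]
    have : x ∈ l₁ → x ∉ l₂ := fun h h' => hd x h x (List.mem_cons_of_mem _ h') rfl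
    tauto

/-- If a statistic on words factors at the letter `M` into a statistic of the part before `M`,
one of the part after `M`, and an interaction `φ` that only depends on the lengths of these two
parts, then its sum over all words is a binomial convolution, provided that the two sums over
words on smaller sets only depend on the number of letters. -/
theorem sum_words_insert_eq {R : Type*} [CommRing R] {s : Finset ℕ} {M : ℕ} (hM : M ∉ s)
    {g g₁ g₂ : List ℕ → R} {φ : ℕ → ℕ → R} {c₁ c₂ : ℕ → R}
    (hg : ∀ l₁ l₂ : List ℕ, (∀ x ∈ l₁, x ∈ s) → (∀ x ∈ l₂, x ∈ s) →
      g (l₁ ++ M :: l₂) = φ l₁.length l₂.length * (g₁ l₁ * g₂ l₂))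
    (h₁ : ∀ A ⊆ s, ∑ l ∈ words A, g₁ l = c₁ A.card)
    (h₂ : ∀ A ⊆ s, ∑ l ∈ words A, g₂ l = c₂ A.card) :
    ∑ l ∈ words (insert M s), g l = ∑ k ∈ Finset.range (s.card + 1),
      s.card.choose k • (φ k (s.card - k) * (c₁ k * c₂ (s.card - k))) := by
  rw [sum_words_insert hM, ← Finset.sum_powerset_apply_card
    (fun k => φ k (s.card - k) * (c₁ k * c₂ (s.card - k)))]
  refine Finset.sum_congr rfl fun A hA => ?_
  rw [Finset.mem_powerset] at hA
  rw [← h₁ A hA, ← Finset.card_sdiff_of_subset hA, ← h₂ _ Finset.sdiff_subset,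
    Finset.sum_mul_sum, Finset.mul_sum]
  refine Finset.sum_congr rfl fun l₁ hl₁ => ?_
  rw [Finset.mul_sum]
  refine Finset.sum_congr rfl fun l₂ hl₂ => ?_
  rw [hg l₁ l₂ (fun x hx => hA ((mem_of_mem_words hl₁).mp hx))
    (fun x hx => (Finset.mem_sdiff.mp ((mem_of_mem_words hl₂).mp hx)).1),
    length_of_mem_words hl₁, length_of_mem_words hl₂]

/-! ### Statistics of words between two boundary letters -/

/-- The number of letters `x` of the word `l`, flanked by the extra letters `a` on the left and
`b` on the right, that satisfy `p w x y` for their neighbours `w` and `y`. -/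
def tripleCount (p : ℕ → ℕ → ℕ → Prop) [∀ w x y, Decidable (p w x y)] :
    ℕ → List ℕ → ℕ → ℕ
  | _, [], _ => 0
  | a, x :: l, b => (if p a x (l.headD b) then 1 else 0) + tripleCount p x l b

theorem tripleCount_append_cons (p : ℕ → ℕ → ℕ → Prop) [∀ w x y, Decidable (p w x y)]
    (a b M : ℕ) (l₁ l₂ : List ℕ) :
    tripleCount p a (l₁ ++ M :: l₂) b = tripleCount p a l₁ M +
      (if p (l₁.getLastD a) M (l₂.headD b) then 1 else 0) + tripleCount p M l₂ b := by
  induction l₁ generalizing a with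
  | nil => simp [tripleCount]
  | cons x l₁ ih =>
    have h : (l₁ ++ M :: l₂).headD b = l₁.headD M := by cases l₁ <;> rfl
    rw [List.cons_append, tripleCount, ih, h, tripleCount, List.getLastD_cons]
    ring

/-- The number of right-to-left maxima of a word. -/
def rlMaxCount : List ℕ → ℕ
  | [] => 0
  | x :: l => (if ∀ y ∈ l, y < x then 1 else 0) + rlMaxCount l

theorem rlMaxCount_append_cons {M : ℕ} {l₁ l₂ : List ℕ} (h₁ : ∀ x ∈ l₁, x < M)
    (h₂ : ∀ x ∈ l₂, x < M) : rlMaxCount (l₁ ++ M :: l₂) = rlMaxCount l₂ + 1 := by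
  induction l₁ with
  | nil => rw [List.nil_append, rlMaxCount, if_pos h₂, add_comm]
  | cons x l₁ ih =>
    have hx := h₁ x (by simp)
    rw [List.cons_append, rlMaxCount, if_neg, zero_add, ih fun y hy => h₁ y (by simp [hy])]
    exact fun h => absurd (h M (by simp)) (by omega)

/-- The number of left-to-right maxima of a word. -/
def lrMaxCount (l : List ℕ) : ℕ := rlMaxCount l.reverse

theorem lrMaxCount_append_cons {M : ℕ} {l₁ l₂ : List ℕ} (h₁ : ∀ x ∈ l₁, x < M)
    (h₂ : ∀ x ∈ l₂, x < M) : lrMaxCount (l₁ ++ M :: l₂) = lrMaxCount l₁ + 1 := by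
  rw [lrMaxCount, List.reverse_append, List.reverse_cons, List.append_assoc,
    List.singleton_append, rlMaxCount_append_cons (by simpa using h₂) (by simpa using h₁),
    lrMaxCount]

/-- A letter `x` with left neighbour `w` and right neighbour `y` is a valley. -/
abbrev IsValley (w x y : ℕ) : Prop := w > x ∧ x < y

/-- A letter `x` with left neighbour `w` and right neighbour `y` is a peak. -/
abbrev IsPeak (w x y : ℕ) : Prop := w < x ∧ x > y

/-- A letter `x` with left neighbour `w` and right neighbour `y` is a double descent. -/
abbrev IsDoubleDescent (w x y : ℕ) : Prop := w > x ∧ x > y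

/-- A letter `x` with left neighbour `w` and right neighbour `y` is a double ascent. -/
abbrev IsDoubleAscent (w x y : ℕ) : Prop := w < x ∧ x < y

section Weight

variable {R : Type*} [CommRing R] (u₁ u₂ u₃ u₄ : R)

/-- The weight of a word flanked by the letters `a` and `b`: a factor `u₁` for each valley, `u₂`
for each peak, `u₃` for each double descent and `u₄` for each double ascent. -/
def wordWeight (a : ℕ) (l : List ℕ) (b : ℕ) : R :=
  u₁ ^ tripleCount IsValley a l b * u₂ ^ tripleCount IsPeak a l b *
    u₃ ^ tripleCount IsDoubleDescent a l b * u₄ ^ tripleCount IsDoubleAscent a l b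

@[simp] theorem wordWeight_nil (a b : ℕ) : wordWeight u₁ u₂ u₃ u₄ a [] b = 1 := by
  simp [wordWeight, tripleCount]

/-- The weight of the letter `x` between its neighbours `w` and `y`, which differ from `x`. -/
def letterWeight (w x y : ℕ) : R :=
  if w > x then (if y > x then u₁ else u₃) else (if y > x then u₄ else u₂)

theorem wordWeight_append_cons {a b M : ℕ} {l₁ l₂ : List ℕ} (h₁ : l₁.getLastD a ≠ M)
    (h₂ : l₂.headD b ≠ M) :
    wordWeight u₁ u₂ u₃ u₄ a (l₁ ++ M :: l₂) b =
      letterWeight u₁ u₂ u₃ u₄ (l₁.getLastD a) M (l₂.headD b) *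
        (wordWeight u₁ u₂ u₃ u₄ a l₁ M * wordWeight u₁ u₂ u₃ u₄ M l₂ b) := by
  simp only [wordWeight, tripleCount_append_cons, pow_add, letterWeight]
  generalize l₁.getLastD a = w at *
  generalize l₂.headD b = y at *
  rcases lt_or_gt_of_ne h₁ with h₁ | h₁ <;> rcases lt_or_gt_of_ne h₂ with h₂ | h₂ <;>
    simp [IsValley, IsPeak, IsDoubleDescent, IsDoubleAscent, h₁, h₂,
      h₁.not_gt, h₂.not_gt] <;> ring

theorem getLastD_cases {l : List ℕ} {M : ℕ} (h : ∀ x ∈ l, x < M) (a : ℕ) :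
    l.getLastD a = a ∧ l.length = 0 ∨ l.getLastD a < M ∧ l.length ≠ 0 := by
  rcases eq_or_ne l [] with rfl | hl
  · simp
  · refine Or.inr ⟨h _ ?_, by simpa using hl⟩
    rw [List.getLastD_eq_getLast?, List.getLast?_eq_some_getLast hl]
    exact List.getLast_mem hl

theorem headD_cases {l : List ℕ} {M : ℕ} (h : ∀ x ∈ l, x < M) (b : ℕ) :
    l.headD b = b ∧ l.length = 0 ∨ l.headD b < M ∧ l.length ≠ 0 := by
  cases l with
  | nil => simp
  | cons x l => exact Or.inr ⟨h _ (by simp), by simp⟩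

/-- The weight of a word with largest letter `M`. -/
theorem wordWeight_append_max_cons {a b M : ℕ} {l₁ l₂ : List ℕ} (ha : a ≠ M) (hb : b ≠ M)
    (h₁ : ∀ x ∈ l₁, x < M) (h₂ : ∀ x ∈ l₂, x < M) :
    wordWeight u₁ u₂ u₃ u₄ a (l₁ ++ M :: l₂) b =
      (if l₁.length = 0 ∧ a > M then (if l₂.length = 0 ∧ b > M then u₁ else u₃)
        else (if l₂.length = 0 ∧ b > M then u₄ else u₂)) *
        (wordWeight u₁ u₂ u₃ u₄ a l₁ M * wordWeight u₁ u₂ u₃ u₄ M l₂ b) := by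
  have hl : l₁.getLastD a ≠ M ∧ (l₁.getLastD a > M ↔ l₁.length = 0 ∧ a > M) := by
    rcases getLastD_cases h₁ a with h | h <;> omega
  have hr : l₂.headD b ≠ M ∧ (l₂.headD b > M ↔ l₂.length = 0 ∧ b > M) := by
    rcases headD_cases h₂ b with h | h <;> omega
  rw [wordWeight_append_cons _ _ _ _ hl.1 hr.1, letterWeight]
  simp only [hl.2, hr.2]

end Weight

/-! ### Generating functions of words between boundary letters -/

section WordSeries

variable {R : Type*} [CommRing R] [Algebra ℚ R]

/-- The largest letter of a nonempty word between two larger letters is a valley, a double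
ascent, a double descent or a peak according to which of the two parts of the word around it
are empty. Hence the generating function of the nonempty words satisfies the Riccati equation of
`derivative_C_mul_F`. -/
theorem sum_wordWeight {u₁ u₂ u₃ u₄ x y : R} (hadd : x + y = u₃ + u₄) (hmul : x * y = u₁ * u₂)
    (s : Finset ℕ) (a b : ℕ) (ha : ∀ x ∈ s, x < a) (hb : ∀ x ∈ s, x < b) :
    ∑ l ∈ words s, wordWeight u₁ u₂ u₃ u₄ a l b = egfCoeff s.card (1 + C u₁ * F x y) := by
  induction hn : s.card using Nat.strong_induction_on generalizing s a b with
  | _ n ih =>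
  subst hn
  induction s using Finset.induction_on_max with
  | empty => simp [words_empty, constantCoeff_C_mul_F]
  | insert M s hM _ =>
    have hMs : M ∉ s := fun h => (hM M h).false
    have hMa := ha M (by simp)
    have hMb := hb M (by simp)
    rw [Finset.card_insert_of_notMem hMs] at ih ⊢
    rw [sum_words_insert_eq hMs
      (g₁ := fun l => wordWeight u₁ u₂ u₃ u₄ a l M) (g₂ := fun l => wordWeight u₁ u₂ u₃ u₄ M l b)
      (φ := fun k j => if k = 0 then (if j = 0 then u₁ else u₃) else (if j = 0 then u₄ else u₂))
      (c₁ := fun k => egfCoeff k (1 + C u₁ * F x y))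
      (c₂ := fun k => egfCoeff k (1 + C u₁ * F x y)) ?_ ?_ ?_]
    · have hD : d⁄dX R (1 + C u₁ * F x y) = C u₁ * (1 * 1) + C u₃ * (1 * (C u₁ * F x y)) +
          C u₄ * ((C u₁ * F x y) * 1) + C u₂ * ((C u₁ * F x y) * (C u₁ * F x y)) := by
        rw [map_add, derivative_C_mul_F hadd hmul, map_add, derivative_one]
        ring
      have hS := constantCoeff_C_mul_F u₁ x y
      rw [egfCoeff_succ, hD]
      generalize C u₁ * F x y = S at hS ⊢
      simp only [egfCoeff_add, egfCoeff_C_mul]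
      simp only [egfCoeff_mul, Finset.mul_sum, ← Finset.sum_add_distrib]
      refine Finset.sum_congr rfl fun k _ => ?_
      simp only [nsmul_eq_mul, egfCoeff_one]
      generalize s.card - k = j
      rcases k with _ | k <;> rcases j with _ | j <;> simp [hS] <;> ring
    · intro l₁ l₂ h₁ h₂
      rw [wordWeight_append_max_cons _ _ _ _ hMa.ne' hMb.ne' (fun z hz => hM z (h₁ z hz))
        (fun z hz => hM z (h₂ z hz))]
      simp [hMa, hMb]
    · exact fun A hA => ih _ (Nat.lt_succ_of_le (Finset.card_le_card hA)) A a M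
        (fun z hz => ha z (Finset.mem_insert_of_mem (hA hz))) (fun z hz => hM z (hA hz)) rfl
    · exact fun A hA => ih _ (Nat.lt_succ_of_le (Finset.card_le_card hA)) A M b
        (fun z hz => hM z (hA hz)) (fun z hz => hb z (Finset.mem_insert_of_mem (hA hz))) rfl

/-- Words between a small letter on the left and a large letter on the right, with `α` marking
left-to-right maxima. The part after the largest letter is a word between two large letters. -/
theorem sum_wordWeight_mul_pow_lrMaxCount {u₁ u₂ u₃ u₄ x y : R} (hadd : x + y = u₃ + u₄)
    (hmul : x * y = u₁ * u₂) (α : R) (s : Finset ℕ) (a b : ℕ) (ha : ∀ x ∈ s, a < x)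
    (hb : ∀ x ∈ s, x < b) :
    ∑ l ∈ words s, wordWeight u₁ u₂ u₃ u₄ a l b * α ^ lrMaxCount l =
      egfCoeff s.card (closedForm x y (u₃ - u₄) α 0) := by
  induction hn : s.card using Nat.strong_induction_on generalizing s a b with
  | _ n ih =>
  subst hn
  induction s using Finset.induction_on_max with
  | empty => simp [words_empty, constantCoeff_closedForm, lrMaxCount, rlMaxCount]
  | insert M s hM _ =>
    have hMs : M ∉ s := fun h => (hM M h).false
    have hMa := ha M (by simp)
    have hMb := hb M (by simp)
    rw [Finset.card_insert_of_notMem hMs] at ih ⊢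
    rw [sum_words_insert_eq hMs
      (g₁ := fun l => wordWeight u₁ u₂ u₃ u₄ a l M * α ^ lrMaxCount l)
      (g₂ := fun l => wordWeight u₁ u₂ u₃ u₄ M l b)
      (φ := fun _ j => (if j = 0 then u₄ else u₂) * α)
      (c₁ := fun k => egfCoeff k (closedForm x y (u₃ - u₄) α 0))
      (c₂ := fun k => egfCoeff k (1 + C u₁ * F x y)) ?_ ?_ ?_]
    · have hD := derivative_closedForm hadd hmul α 0
      have hS := constantCoeff_C_mul_F u₁ x y
      rw [egfCoeff_succ, hD]
      generalize C u₁ * F x y = S at hS ⊢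
      generalize closedForm x y (u₃ - u₄) α 0 = T
      have hE : (C (α * u₄ + 0 * u₃) + C ((α + 0) * u₂) * S) * T =
          C (α * u₄) * (T * 1) + C (α * u₂) * (T * S) := by
        rw [zero_mul, add_zero, add_zero]
        ring
      rw [hE]
      simp only [egfCoeff_add, egfCoeff_C_mul]
      simp only [egfCoeff_mul, Finset.mul_sum, ← Finset.sum_add_distrib]
      refine Finset.sum_congr rfl fun k _ => ?_
      simp only [nsmul_eq_mul, egfCoeff_one]
      generalize s.card - k = j
      rcases j with _ | j <;> simp [hS] <;> ring
    · intro l₁ l₂ h₁ h₂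
      have h₁' := fun z hz => hM z (h₁ z hz)
      have h₂' := fun z hz => hM z (h₂ z hz)
      rw [wordWeight_append_max_cons _ _ _ _ hMa.ne hMb.ne' h₁' h₂',
        lrMaxCount_append_cons h₁' h₂']
      simp only [hMa.not_gt, hMb, and_false, and_true, if_false]
      ring
    · exact fun A hA => ih _ (Nat.lt_succ_of_le (Finset.card_le_card hA)) A a M
        (fun z hz => ha z (Finset.mem_insert_of_mem (hA hz))) (fun z hz => hM z (hA hz)) rfl
    · exact fun A hA => sum_wordWeight hadd hmul A M b
        (fun z hz => hM z (hA hz)) (fun z hz => hb z (Finset.mem_insert_of_mem (hA hz)))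

/-- Words between a large letter on the left and a small letter on the right, with `β` marking
right-to-left maxima. The part before the largest letter is a word between two large letters. -/
theorem sum_wordWeight_mul_pow_rlMaxCount {u₁ u₂ u₃ u₄ x y : R} (hadd : x + y = u₃ + u₄)
    (hmul : x * y = u₁ * u₂) (β : R) (s : Finset ℕ) (a b : ℕ) (ha : ∀ x ∈ s, x < a)
    (hb : ∀ x ∈ s, b < x) :
    ∑ l ∈ words s, wordWeight u₁ u₂ u₃ u₄ a l b * β ^ rlMaxCount l =
      egfCoeff s.card (closedForm x y (u₃ - u₄) 0 β) := by
  induction hn : s.card using Nat.strong_induction_on generalizing s a b with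
  | _ n ih =>
  subst hn
  induction s using Finset.induction_on_max with
  | empty => simp [words_empty, constantCoeff_closedForm, rlMaxCount]
  | insert M s hM _ =>
    have hMs : M ∉ s := fun h => (hM M h).false
    have hMa := ha M (by simp)
    have hMb := hb M (by simp)
    rw [Finset.card_insert_of_notMem hMs] at ih ⊢
    rw [sum_words_insert_eq hMs
      (g₁ := fun l => wordWeight u₁ u₂ u₃ u₄ a l M)
      (g₂ := fun l => wordWeight u₁ u₂ u₃ u₄ M l b * β ^ rlMaxCount l)
      (φ := fun k _ => (if k = 0 then u₃ else u₂) * β)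
      (c₁ := fun k => egfCoeff k (1 + C u₁ * F x y))
      (c₂ := fun k => egfCoeff k (closedForm x y (u₃ - u₄) 0 β)) ?_ ?_ ?_]
    · have hD := derivative_closedForm hadd hmul 0 β
      have hS := constantCoeff_C_mul_F u₁ x y
      rw [egfCoeff_succ, hD]
      generalize C u₁ * F x y = S at hS ⊢
      generalize closedForm x y (u₃ - u₄) 0 β = T
      have hE : (C (0 * u₄ + β * u₃) + C ((0 + β) * u₂) * S) * T =
          C (β * u₃) * (1 * T) + C (β * u₂) * (S * T) := by
        rw [zero_mul, zero_add, zero_add]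
        ring
      rw [hE]
      simp only [egfCoeff_add, egfCoeff_C_mul]
      simp only [egfCoeff_mul, Finset.mul_sum, ← Finset.sum_add_distrib]
      refine Finset.sum_congr rfl fun k _ => ?_
      simp only [nsmul_eq_mul, egfCoeff_one]
      generalize s.card - k = j
      rcases k with _ | k <;> simp [hS] <;> ring
    · intro l₁ l₂ h₁ h₂
      have h₁' := fun z hz => hM z (h₁ z hz)
      have h₂' := fun z hz => hM z (h₂ z hz)
      rw [wordWeight_append_max_cons _ _ _ _ hMa.ne' hMb.ne h₁' h₂',
        rlMaxCount_append_cons h₁' h₂']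
      simp only [hMb.not_gt, hMa, and_false, and_true, if_false]
      ring
    · exact fun A hA => sum_wordWeight hadd hmul A a M
        (fun z hz => ha z (Finset.mem_insert_of_mem (hA hz))) (fun z hz => hM z (hA hz))
    · exact fun A hA => ih _ (Nat.lt_succ_of_le (Finset.card_le_card hA)) A M b
        (fun z hz => hM z (hA hz)) (fun z hz => hb z (Finset.mem_insert_of_mem (hA hz))) rfl

/-- Words between two small letters. The largest letter is a peak, a left-to-right maximum and a
right-to-left maximum; it contributes the factor `1` because the corresponding exponents are
lowered by `1`. -/
theorem sum_word_statistics {u₁ u₂ u₃ u₄ x y : R} (hadd : x + y = u₃ + u₄)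
    (hmul : x * y = u₁ * u₂) (α β : R) {s : Finset ℕ} {M : ℕ} (h0 : ∀ z ∈ s, 0 < z)
    (hM : ∀ z ∈ s, z < M) (hM0 : 0 < M) :
    ∑ l ∈ words (insert M s), u₁ ^ tripleCount IsValley 0 l 0 *
        u₂ ^ (tripleCount IsPeak 0 l 0 - 1) * u₃ ^ tripleCount IsDoubleDescent 0 l 0 *
        u₄ ^ tripleCount IsDoubleAscent 0 l 0 * α ^ (lrMaxCount l - 1) * β ^ (rlMaxCount l - 1) =
      egfCoeff s.card (closedForm x y (u₃ - u₄) α β) := by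
  rw [sum_words_insert_eq (fun h => (hM M h).false)
    (g₁ := fun l => wordWeight u₁ u₂ u₃ u₄ 0 l M * α ^ lrMaxCount l)
    (g₂ := fun l => wordWeight u₁ u₂ u₃ u₄ M l 0 * β ^ rlMaxCount l)
    (φ := fun _ _ => 1)
    (c₁ := fun k => egfCoeff k (closedForm x y (u₃ - u₄) α 0))
    (c₂ := fun k => egfCoeff k (closedForm x y (u₃ - u₄) 0 β)) ?_ ?_ ?_]
  · rw [← closedForm_mul hadd hmul α β, egfCoeff_mul]
    simp only [one_mul]
  · intro l₁ l₂ h₁ h₂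
    have h₁' := fun z hz => hM z (h₁ z hz)
    have h₂' := fun z hz => hM z (h₂ z hz)
    have hl : l₁.getLastD 0 < M := by
      rcases getLastD_cases h₁' 0 with h | h <;> omega
    have hr : l₂.headD 0 < M := by
      rcases headD_cases h₂' 0 with h | h <;> omega
    have e1 : ¬ IsValley (l₁.getLastD 0) M (l₂.headD 0) := fun h => h.1.not_gt hl
    have e2 : IsPeak (l₁.getLastD 0) M (l₂.headD 0) := ⟨hl, hr⟩
    have e3 : ¬ IsDoubleDescent (l₁.getLastD 0) M (l₂.headD 0) := fun h => h.1.not_gt hl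
    have e4 : ¬ IsDoubleAscent (l₁.getLastD 0) M (l₂.headD 0) := fun h => h.2.not_gt hr
    -- The peak `M` is the one removed by the exponent `W - 1`.
    have e5 (i j : ℕ) : i + 1 + j - 1 = i + j := by omega
    rw [lrMaxCount_append_cons h₁' h₂', rlMaxCount_append_cons h₁' h₂']
    simp only [tripleCount_append_cons, if_neg e1, if_pos e2, if_neg e3, if_neg e4, add_zero, e5,
      Nat.add_sub_cancel, wordWeight, pow_add]
    ring
  · exact fun A hA => sum_wordWeight_mul_pow_lrMaxCount hadd hmul α A 0 M
      (fun z hz => h0 z (hA hz)) (fun z hz => hM z (hA hz))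
  · exact fun A hA => sum_wordWeight_mul_pow_rlMaxCount hadd hmul β A M 0
      (fun z hz => hM z (hA hz)) (fun z hz => h0 z (hA hz))

end WordSeries

/-! ### From words to permutations -/

/-- The word `σ_1 ⋯ σ_m` of a permutation. -/
def wordOf {m : ℕ} (σ : Equiv.Perm (Fin m)) : List ℕ := List.ofFn fun i => (σ i : ℕ) + 1

theorem length_wordOf {m : ℕ} (σ : Equiv.Perm (Fin m)) : (wordOf σ).length = m := by
  simp [wordOf]

@[simp] theorem letter_zero {m : ℕ} (σ : Equiv.Perm (Fin m)) : letter σ 0 = 0 := by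
  simp [letter]

/-- Positions are counted from `1` in `letter` and from `0` in lists; the default value `0` of
`List.getD` is the convention `σ_{m+1} = 0`. -/
theorem letter_succ {m : ℕ} (σ : Equiv.Perm (Fin m)) (i : ℕ) :
    letter σ (i + 1) = (wordOf σ).getD i 0 := by
  by_cases h : i < m
  · rw [letter, dif_pos (by omega), List.getD_eq_getElem _ _ (by rwa [length_wordOf])]
    simp [wordOf]
  · rw [letter, dif_neg (by omega), List.getD_eq_default _ _ (by rw [length_wordOf]; omega)]

theorem letter_eq {m : ℕ} (σ : Equiv.Perm (Fin m)) (i : ℕ) :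
    letter σ i = (0 :: wordOf σ).getD i 0 := by
  cases i with
  | zero => simp
  | succ i => rw [letter_succ, List.getD_cons_succ]

/-- Permutations of `[m]` correspond to the words on the letters `1, …, m`. -/
theorem sum_wordOf {R : Type*} [AddCommMonoid R] (m : ℕ) (g : List ℕ → R) :
    ∑ σ : Equiv.Perm (Fin m), g (wordOf σ) = ∑ l ∈ words (Finset.Icc 1 m), g l := by
  refine Finset.sum_bij (fun σ _ => wordOf σ) ?_ ?_ ?_ (fun _ _ => rfl)
  · intro σ _
    rw [mem_words]
    refine ⟨List.nodup_ofFn.mpr fun i j h => σ.injective (Fin.ext (by simpa using h)), ?_⟩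
    ext x
    simp only [List.mem_toFinset, wordOf, List.mem_ofFn, Finset.mem_Icc]
    constructor
    · rintro ⟨i, rfl⟩
      omega
    · rintro ⟨h1, h2⟩
      exact ⟨σ.symm ⟨x - 1, by omega⟩, by simp only [Equiv.apply_symm_apply]; omega⟩
  · intro σ _ τ _ h
    have := List.ofFn_injective h
    ext i
    simpa using congrFun this i
  · intro l hl
    have hlen : l.length = m := by simp [length_of_mem_words hl]
    have hI (i : Fin m) : 1 ≤ l[(i : ℕ)] ∧ l[(i : ℕ)] ≤ m := by
      rw [← Finset.mem_Icc, ← mem_of_mem_words hl]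
      exact List.getElem_mem _
    let f : Fin m → Fin m := fun i => ⟨l[(i : ℕ)] - 1, by have := hI i; omega⟩
    have hf : Function.Injective f := by
      intro i j h
      have h1 : l[(i : ℕ)] - 1 = l[(j : ℕ)] - 1 := congrArg Fin.val h
      have h2 : l[(i : ℕ)] = l[(j : ℕ)] := by have := hI i; have := hI j; omega
      exact Fin.ext ((mem_words.mp hl).1.getElem_inj_iff.mp h2)
    refine ⟨Equiv.ofBijective f (Finite.injective_iff_bijective.mp hf), Finset.mem_univ _, ?_⟩
    refine List.ext_getElem (by rw [length_wordOf, hlen]) fun i h1 h2 => ?_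
    have : 1 ≤ l[i] := (hI ⟨i, by omega⟩).1
    simp only [wordOf, List.getElem_ofFn, Equiv.ofBijective_apply, f]
    omega

theorem card_filter_Icc_one (m : ℕ) (q : ℕ → Prop) [DecidablePred q] :
    ((Finset.Icc 1 m).filter q).card = ∑ i ∈ Finset.range m, if q (i + 1) then 1 else 0 := by
  have h : Finset.Icc 1 m = Finset.Ico 1 (m + 1) := by
    ext
    simp only [Finset.mem_Icc, Finset.mem_Ico]
    omega
  rw [Finset.card_filter, h, Finset.sum_Ico_eq_sum_range]
  simp only [Nat.add_sub_cancel, add_comm 1]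

theorem tripleCount_eq_sum (p : ℕ → ℕ → ℕ → Prop) [∀ w x y, Decidable (p w x y)] (a : ℕ)
    (l : List ℕ) : tripleCount p a l 0 = ∑ i ∈ Finset.range l.length,
      if p ((a :: l).getD i 0) (l.getD i 0) (l.getD (i + 1) 0) then 1 else 0 := by
  induction l generalizing a with
  | nil => simp [tripleCount]
  | cons x l ih =>
    rw [tripleCount, ih, List.length_cons, Finset.sum_range_succ', add_comm]
    cases l <;> simp

theorem card_filter_letter {m : ℕ} (σ : Equiv.Perm (Fin m)) (p : ℕ → ℕ → ℕ → Prop)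
    [∀ w x y, Decidable (p w x y)] :
    ((Finset.Icc 1 m).filter fun i =>
      p (letter σ (i - 1)) (letter σ i) (letter σ (i + 1))).card =
      tripleCount p 0 (wordOf σ) 0 := by
  rw [card_filter_Icc_one, tripleCount_eq_sum, length_wordOf]
  simp only [letter_succ, Nat.add_sub_cancel, letter_eq]

theorem rlMaxCount_eq_sum (l : List ℕ) : rlMaxCount l = ∑ i ∈ Finset.range l.length,
    if ∀ j < l.length, i < j → l.getD j 0 < l.getD i 0 then 1 else 0 := by
  induction l with
  | nil => simp [rlMaxCount]
  | cons x l ih =>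
    rw [rlMaxCount, ih, List.length_cons, Finset.sum_range_succ', add_comm]
    congr 1
    · refine Finset.sum_congr rfl fun i _ => if_congr ?_ rfl rfl
      rw [Nat.forall_lt_succ_left]
      simp
    · refine if_congr ?_ rfl rfl
      rw [Nat.forall_lt_succ_left]
      simp only [lt_irrefl, List.getD_cons_zero, List.getD_cons_succ, false_imp_iff,
        Nat.succ_pos, true_imp_iff, true_and, List.forall_mem_iff_getElem]
      exact forall₂_congr fun j hj => by rw [List.getD_eq_getElem _ _ hj]

theorem rlMax_eq {m : ℕ} (σ : Equiv.Perm (Fin m)) : rlMax σ = rlMaxCount (wordOf σ) := by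
  rw [rlMax, card_filter_Icc_one, rlMaxCount_eq_sum, length_wordOf]
  refine Finset.sum_congr rfl fun i _ => if_congr ?_ rfl rfl
  constructor
  · intro h j hj hij
    simpa only [letter_succ] using h (j + 1) (by simp; omega) (by omega)
  · intro h j hj hij
    obtain ⟨h1, h2⟩ := Finset.mem_Icc.mp hj
    obtain ⟨j, rfl⟩ := Nat.exists_eq_add_of_le' h1
    simpa only [letter_succ] using h j (by omega) (by omega)

/-- Reversing the word turns left-to-right maxima into right-to-left maxima. -/
theorem lrMax_eq {m : ℕ} (σ : Equiv.Perm (Fin m)) : lrMax σ = lrMaxCount (wordOf σ) := by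
  have hrev (i : ℕ) (hi : i < m) :
      (wordOf σ).reverse.getD i 0 = (wordOf σ).getD (m - 1 - i) 0 := by
    rw [List.getD_reverse _ (by rwa [length_wordOf]), length_wordOf]
  rw [lrMax, card_filter_Icc_one, lrMaxCount, rlMaxCount_eq_sum, List.length_reverse,
    length_wordOf, ← Finset.sum_range_reflect]
  refine Finset.sum_congr rfl fun i hi => if_congr ?_ rfl rfl
  have hi := Finset.mem_range.mp hi
  rw [letter_succ]
  constructor
  · intro h j hj hij
    rw [hrev j hj, hrev i hi]
    simpa only [letter_succ] using h (m - 1 - j + 1) (by simp; omega) (by omega)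
  · intro h j hj hij
    obtain ⟨h1, h2⟩ := Finset.mem_Icc.mp hj
    obtain ⟨j, rfl⟩ := Nat.exists_eq_add_of_le' h1
    have := h (m - 1 - j) (by omega) (by omega)
    rw [hrev _ (by omega), hrev i hi, show m - 1 - (m - 1 - j) = j by omega] at this
    simpa only [letter_succ] using this

/-- The first letter is never a double descent, since it is preceded by `0`. -/
theorem rightDoubleDescents_eq {m : ℕ} (σ : Equiv.Perm (Fin m)) :
    rightDoubleDescents σ = tripleCount IsDoubleDescent 0 (wordOf σ) 0 := by
  rw [← card_filter_letter, rightDoubleDescents]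
  congr 1
  ext i
  simp only [Finset.mem_filter, Finset.mem_Ioc, Finset.mem_Icc]
  refine ⟨fun h => ⟨by omega, h.2⟩, fun h => ⟨⟨?_, h.1.2⟩, h.2⟩⟩
  by_contra hi
  obtain rfl : i = 1 := by omega
  simpa using h.2.1

/-- The last letter is never a double ascent, since it is followed by `0`. -/
theorem leftDoubleAscents_eq {m : ℕ} (σ : Equiv.Perm (Fin m)) :
    leftDoubleAscents σ = tripleCount IsDoubleAscent 0 (wordOf σ) 0 := by
  rw [← card_filter_letter, leftDoubleAscents]
  congr 1
  ext i
  simp only [Finset.mem_filter, Finset.mem_Ico, Finset.mem_Icc]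
  refine ⟨fun h => ⟨by omega, h.2⟩, fun h => ⟨⟨h.1.1, ?_⟩, h.2⟩⟩
  by_contra hi
  obtain rfl : i = m := by omega
  have h1 : letter σ (i + 1) = 0 := by rw [letter, dif_neg (by omega)]
  have := h.2.2
  omega

theorem P_eq_egfCoeff {R : Type*} [CommRing R] [Algebra ℚ R] {u₁ u₂ u₃ u₄ x y : R}
    (hadd : x + y = u₃ + u₄) (hmul : x * y = u₁ * u₂) (α β : R) (n : ℕ) :
    P n u₁ u₂ u₃ u₄ α β = egfCoeff n (closedForm x y (u₃ - u₄) α β) := by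
  have h := sum_word_statistics (s := Finset.Icc 1 n) (M := n + 1) hadd hmul α β
    (fun z hz => (Finset.mem_Icc.mp hz).1) (fun z hz => Nat.lt_succ_of_le (Finset.mem_Icc.mp hz).2)
    n.succ_pos
  have hI : insert (n + 1) (Finset.Icc 1 n) = Finset.Icc 1 (n + 1) := by
    ext
    simp only [Finset.mem_insert, Finset.mem_Icc]
    omega
  rw [hI, ← sum_wordOf, Nat.card_Icc,
    Nat.add_sub_cancel] at h
  rw [← h, P]
  refine Finset.sum_congr rfl fun σ _ => ?_
  rw [valleys, exteriorPeaks, card_filter_letter σ IsValley, card_filter_letter σ IsPeak,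
    rightDoubleDescents_eq, leftDoubleAscents_eq, lrMax_eq, rlMax_eq]

end DescentStirling

theorem mainTheorem1 {R : Type*} [CommRing R] [Algebra ℚ R]
    (u₁ u₂ u₃ u₄ α β x y : R) (hadd : x + y = u₃ + u₄) (hmul : x * y = u₁ * u₂) :
    DescentStirling.egf (fun n => DescentStirling.P n u₁ u₂ u₃ u₄ α β) =
      DescentStirling.onePlusPow (PowerSeries.C y * DescentStirling.F x y)
          ((1 / 2 : ℚ) • (α + β)) *
        DescentStirling.onePlusPow (PowerSeries.C x * DescentStirling.F x y)
          ((1 / 2 : ℚ) • (α + β)) *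
        DescentStirling.expSeries ((1 / 2 : ℚ) • ((β - α) * (u₃ - u₄))) := by
  simp only [DescentStirling.P_eq_egfCoeff hadd hmul, DescentStirling.egf_egfCoeff]
  rfl
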